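/- Let $k$ be an algebraically closed field of characteristic zero (for instance $k=\mathbb{C}$). Let $1<q<n$ be coprime integers with Hirzebruch--Jung continued fraction expansion $\frac{n}{q}=[\alpha_1,\dots,\alpha_N]$ (all $\alpha_i\geq 2$), and assume $\alpha_1\geq 3$; then $N\geq 2$. Put $s=\sum_{i=1}^N(\alpha_i-2)\geq 1$. **The quiver $Q$.** The vertices are $\star,+,-,1,\dots,N$. The arrows (subscripts give tail and head, $0$ standing for $\star$) are $c_{0+},c_{+1},c_{0-},c_{-1}$, $a_{1+},a_{+0},a_{1-},a_{-0}$, $a_{0N}$, $c_{N0}$, $c_{t,t+1}$ and $a_{t+1,t}$ for $1\leq t<N$, and extra arrows $k_2,\dots,k_s$ to $\star$, where $\alpha_1-3$ of them start at the vertex $1$ and $\alpha_i-2$ start at the vertex $i$ for $i\geq 2$, numbered from left to right. Put also $k_1=a_{+0}$ and $k_{s+1}=c_{N0}$. Write $pq$ for $p$ followed by $q$, and put $C_{0+}=c_{0+}$, $C_{01}=c_{0+}c_{+1}$, $C_{0t}=C_{01}c_{12}\cdots c_{t-1,t}$ and $A_{0t}=a_{0N}a_{N,N-1}\cdots a_{t+1,t}$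 for $1\leq t\leq N$ (so $A_{0N}=a_{0N}$). **The algebra $D_{n,q}$.** Let $B_r\in\{+,1,\dots,N\}$ be the tail of $k_r$; let $u_i$ and $v_i$ be the largest and smallest $2\leq j\leq s+1$ with $B_j=i$ (if one exists), and $u_+=1$. Let $V_i=u_{W_i}$, where $W_i$ is the largest vertex $1\le j<i$ at which an extra arrow starts, or $W_i=+$ if there is none. Then $D_{n,q}$ (in the moduli presentation) is the path algebra $kQ$ modulo the relations $$c_{0+}c_{+1}-c_{0-}c_{-1}=4A_{01},\quad c_{0+}a_{+0}=c_{0-}a_{-0},\quad a_{-0}c_{0-}=c_{-1}a_{1-},\quad a_{1+}c_{+1}=a_{1-}c_{-1},\quad a_{+0}c_{0+}=c_{+1}a_{1+},$$ together with the following. * Step $1$. If $\alpha_1=3$: $c_{12}a_{21}=a_{1+}c_{+1}$. If $\alpha_1>3$: $k_2A_{01}=a_{1+}c_{+1}$, $A_{01}k_2=c_{0+}a_{+0}$, $k_tC_{01}=k_{t+1}A_{01}$ and $C_{01}k_t=A_{01}k_{t+1}$ for $2\leq t<u_1$, and $k_{u_1}C_{01}=c_{12}a_{21}$. * Step $i$,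 for $2\leq i<N$. If $\alpha_i=2$: $c_{i,i+1}a_{i+1,i}=a_{i,i-1}c_{i-1,i}$. If $\alpha_i>2$: $k_{v_i}A_{0i}=a_{i,i-1}c_{i-1,i}$, $A_{0i}k_{v_i}=C_{0B_{V_i}}k_{V_i}$, $k_tC_{0i}=k_{t+1}A_{0i}$ and $C_{0i}k_t=A_{0i}k_{t+1}$ for $v_i\leq t<u_i$, and $k_{u_i}C_{0i}=c_{i,i+1}a_{i+1,i}$. * Step $N$. If $\alpha_N=2$: $c_{N0}a_{0N}=a_{N,N-1}c_{N-1,N}$ and $C_{0B_{V_N}}k_{V_N}=a_{0N}c_{N0}$. If $\alpha_N>2$: $k_{v_N}a_{0N}=a_{N,N-1}c_{N-1,N}$, $a_{0N}k_{v_N}=C_{0B_{V_N}}k_{V_N}$, and $k_tC_{0N}=k_{t+1}a_{0N}$ and $C_{0N}k_t=a_{0N}k_{t+1}$ for $v_N\leq t<u_N$. **The moduli space.** Let $\theta=(-(N+2),1,\dots,1)$, with $-(N+2)$ at $\star$. A representation $M$ of $D_{n,q}$ of dimension vector $(1,\dots,1)$ is $\theta$-stable if $\sum_v\theta_v\dim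 M'_v>0$ for every subrepresentation $0\neq M'\subsetneq M$. Let $\mathcal{M}$ be the moduli space of $\theta$-stable representations of $D_{n,q}$ of dimension vector $(1,\dots,1)$: its points are the isomorphism classes, that is, the orbits of the group $\prod_v GL_1(k)$ on the stable locus of the representation variety, and its topology is the quotient of the Zariski topology. Define subsets of $\mathcal{M}$ by requiring the following arrows and paths to act as non-zero maps: $$\begin{array}{ll} U_0: & C_{0N}\neq 0,\ c_{0-}\neq 0;\\ U_t\ (1\leq t\leq N-1): & C_{0,N-t}\neq 0,\ c_{0-}\neq 0,\ A_{0,N-t+1}\neq 0;\\ U_N: & c_{0+}\neq 0,\ c_{0-}\neq 0,\ A_{01}\neq 0;\\ U_+: & c_{0+}\neq 0,\ A_{01}\neq 0,\ a_{1-}\neq 0;\\ U_-: & c_{0-}\neq 0,\ A_{01}\neq 0,\ a_{1+}\neq 0. \end{array}$$ Then $U_0,\dots,U_N,U_+,U_-$ are open in $\mathcal{M}$ and cover it: $U_0\cup\dots\cup U_N\cup U_+\cup U_-=\mathcal{M}$. -/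

import Mathlib

open scoped Matrix

namespace ReconD

/-! ## Continued fraction data -/

/-- `hjValue α i m` is the Hirzebruch-Jung continued fraction
`[α i, α (i+1), …, α (i+m)] = α i - 1 / (α (i+1) - 1 / (⋯ - 1 / α (i+m)))`. -/
def hjValue (α : ℕ → ℕ) : ℕ → ℕ → ℚ
  | i, 0 => α i
  | i, m + 1 => α i - 1 / hjValue α (i + 1) m

/-- Integers `1 < q < n`, `(n, q) = 1`, together with the Hirzebruch-Jung expansion
`n / q = [α 1, …, α N]` (all `α i ≥ 2`), such that `α 1 ≥ 3` (that is, `ν = 0`).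
Only the values `α 1, …, α N` are ever used. -/
structure Datum where
  n : ℕ
  q : ℕ
  N : ℕ
  α : ℕ → ℕ
  one_lt_q : 1 < q
  q_lt_n : q < n
  coprime : Nat.Coprime n q
  one_le_N : 1 ≤ N
  two_le_α : ∀ i, 1 ≤ i → i ≤ N → 2 ≤ α i
  expansion : (n : ℚ) / q = hjValue α 1 (N - 1)
  nu_eq_zero : 3 ≤ α 1

variable (X : Datum)

/-- `q > 1` forces the expansion to have length at least two. -/
theorem Datum.two_le_N : 2 ≤ X.N := by
  by_contra h
  have hN : X.N = 1 := by have := X.one_le_N; omega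
  have hq : (X.q : ℚ) ≠ 0 := by have := X.one_lt_q; positivity
  have e := X.expansion
  rw [hN, hjValue, div_eq_iff hq] at e
  have e' : X.n = X.α 1 * X.q := by exact_mod_cast e
  have c := X.coprime
  have hd : X.q ∣ 1 := by
    rw [← Nat.Coprime.gcd_eq_one c, e']
    exact Nat.dvd_gcd (Dvd.intro_left _ rfl) dvd_rfl
  have := X.one_lt_q
  have := Nat.le_of_dvd one_pos hd
  omega

namespace Datum

/-- `∑_{p=1}^{i} (α p - 2)`. -/
def partialSum (i : ℕ) : ℕ := ∑ p ∈ Finset.Icc 1 i, (X.α p - 2)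

/-- `∑_{p=1}^{N} (α p - 2)`. -/
def total : ℕ := X.partialSum X.N

/-- The `b`-series of `n / q`: `b r` is the smallest `1 ≤ i ≤ N` with
`r ≤ ∑_{p=1}^{i} (α p - 2)` for `1 ≤ r ≤ total`, and `b (total + 1) = N`. -/
noncomputable def b (r : ℕ) : ℕ :=
  if r = X.total + 1 then X.N else sInf {i | 1 ≤ i ∧ i ≤ X.N ∧ r ≤ X.partialSum i}

theorem b_mem {r : ℕ} (hr : r ∈ Finset.Icc 2 X.total) : X.b r ∈ Finset.Icc 1 X.N := by
  rw [Finset.mem_Icc] at hr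
  have hne : r ≠ X.total + 1 := by omega
  have hs : ({i | 1 ≤ i ∧ i ≤ X.N ∧ r ≤ X.partialSum i} : Set ℕ).Nonempty :=
    ⟨X.N, X.one_le_N, le_rfl, hr.2⟩
  have h := Nat.sInf_mem hs
  rw [b, if_neg hne, Finset.mem_Icc]
  exact ⟨h.1, h.2.1⟩

/-- `u i`: the largest `2 ≤ j ≤ total + 1` with `b j = i` (used only when one exists). -/
noncomputable def u (i : ℕ) : ℕ := sSup {j | 2 ≤ j ∧ j ≤ X.total + 1 ∧ X.b j = i}

/-- `v i`: the smallest `2 ≤ j ≤ total + 1` with `b j = i` (used only when one exists). -/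
noncomputable def v (i : ℕ) : ℕ := sInf {j | 2 ≤ j ∧ j ≤ X.total + 1 ∧ X.b j = i}

/-- The vertices `1 ≤ j < i` that have an extra arrow leaving them. -/
def leftExtra (i : ℕ) : Finset ℕ :=
  (Finset.Ico 1 i).filter fun j => (j = 1 ∧ 3 < X.α j) ∨ (j ≠ 1 ∧ 2 < X.α j)

/-- `V i = u_{W_i}`, where `W_i` is the closest vertex to the left of the vertex `i` with an
extra arrow leaving it, or `W_i = +` if there is none, and `u_+ = 1`. -/
noncomputable def V (i : ℕ) : ℕ :=
  if h : (X.leftExtra i).Nonempty then X.u ((X.leftExtra i).max' h) else 1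

end Datum

/-! ## The quiver -/

/-- The vertices `⋆`, `+`, `-`, `1`, …, `N`. -/
inductive Vertex
  | star
  | plus
  | minus
  | node (i : Finset.Icc 1 X.N)
  deriving DecidableEq, Fintype

/-- The arrows of the quiver. The suffixes name tail and head (`p`, `m`, `0` stand for
`+`, `-`, `⋆`). -/
inductive Arrow
  | c0p
  | cp1
  | c0m
  | cm1
  | a1p
  | ap0
  | a1m
  | am0
  | a0N
  | cN0
  /-- `c_{t,t+1}` -/
  | c (t : Finset.Ico 1 X.N)
  /-- `a_{t+1,t}` -/
  | a (t : Finset.Ico 1 X.N)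
  /-- the extra arrows `k_r`, `2 ≤ r ≤ ∑ (α i - 2)` -/
  | k (r : Finset.Icc 2 X.total)

variable {X} in
/-- The vertex `i`, for `1 ≤ i ≤ N`. -/
def Vertex.mk (i : ℕ) (h1 : 1 ≤ i) (h2 : i ≤ X.N) : Vertex X :=
  .node ⟨i, Finset.mem_Icc.2 ⟨h1, h2⟩⟩

variable {X} in
/-- The vertex where an arrow starts. The extra arrow `k_r` starts at the vertex `b r`, so
`α 1 - 3` of them start at `1` and `α i - 2` at `i ≥ 2`, numbered from left to right. -/
noncomputable def Arrow.tail : Arrow X → Vertex X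
  | .c0p => .star
  | .cp1 => .plus
  | .c0m => .star
  | .cm1 => .minus
  | .a1p => .mk 1 le_rfl X.one_le_N
  | .ap0 => .plus
  | .a1m => .mk 1 le_rfl X.one_le_N
  | .am0 => .minus
  | .a0N => .star
  | .cN0 => .mk X.N X.one_le_N le_rfl
  | .c t => .mk t (Finset.mem_Ico.1 t.2).1 (Finset.mem_Ico.1 t.2).2.le
  | .a t => .mk (t + 1) (Nat.le_add_left _ _) (Finset.mem_Ico.1 t.2).2
  | .k r => .node ⟨X.b r, X.b_mem r.2⟩

variable {X} in
/-- The vertex where an arrow ends. -/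
def Arrow.head : Arrow X → Vertex X
  | .c0p => .plus
  | .cp1 => .mk 1 le_rfl X.one_le_N
  | .c0m => .minus
  | .cm1 => .mk 1 le_rfl X.one_le_N
  | .a1p => .plus
  | .ap0 => .star
  | .a1m => .minus
  | .am0 => .star
  | .a0N => .mk X.N X.one_le_N le_rfl
  | .cN0 => .star
  | .c t => .mk (t + 1) (Nat.le_add_left _ _) (Finset.mem_Ico.1 t.2).2
  | .a t => .mk t (Finset.mem_Ico.1 t.2).1 (Finset.mem_Ico.1 t.2).2.le
  | .k _ => .star

/-! ## Path algebras; `x * y` is `x` followed by `y` -/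

/-- The relations that present the path algebra of a finite quiver (vertex set `I`, arrow set
`E`) by its trivial paths `e_i` and its arrows. -/
inductive PathRel (K : Type*) [Field K] {I E : Type*} [Fintype I] (tail head : E → I) :
    FreeAlgebra K (I ⊕ E) → FreeAlgebra K (I ⊕ E) → Prop
  | idem (i : I) : PathRel K tail head
      (FreeAlgebra.ι K (.inl i) * FreeAlgebra.ι K (.inl i)) (FreeAlgebra.ι K (.inl i))
  | orth (i j : I) : i ≠ j → PathRel K tail head
      (FreeAlgebra.ι K (.inl i) * FreeAlgebra.ι K (.inl j)) 0
  | total : PathRel K tail head (∑ i : I, FreeAlgebra.ι K (.inl i)) 1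
  | tail_mul (x : E) : PathRel K tail head
      (FreeAlgebra.ι K (.inl (tail x)) * FreeAlgebra.ι K (.inr x)) (FreeAlgebra.ι K (.inr x))
  | mul_head (x : E) : PathRel K tail head
      (FreeAlgebra.ι K (.inr x) * FreeAlgebra.ι K (.inl (head x))) (FreeAlgebra.ι K (.inr x))

variable (K : Type*) [Field K]

/-- The path algebra `K Q`. -/
abbrev PathAlg := RingQuot (PathRel K (Arrow.tail (X := X)) Arrow.head)

namespace PathAlg

variable {X}

/-- The trivial path at a vertex. -/
noncomputable def e (i : Vertex X) : PathAlg X K :=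
  RingQuot.mkAlgHom K (PathRel K (Arrow.tail (X := X)) Arrow.head) (FreeAlgebra.ι K (.inl i))

/-- An arrow, as a path of length one. -/
noncomputable def arr (x : Arrow X) : PathAlg X K :=
  RingQuot.mkAlgHom K (PathRel K (Arrow.tail (X := X)) Arrow.head) (FreeAlgebra.ι K (.inr x))

variable (X)

/-- `c_{t,t+1}` for `1 ≤ t < N` (never used for other `t`). -/
noncomputable def c (t : ℕ) : PathAlg X K :=
  if h : t ∈ Finset.Ico 1 X.N then arr K (.c ⟨t, h⟩) else 0

/-- `a_{t+1,t}` for `1 ≤ t < N` (never used for other `t`). -/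
noncomputable def a (t : ℕ) : PathAlg X K :=
  if h : t ∈ Finset.Ico 1 X.N then arr K (.a ⟨t, h⟩) else 0

/-- `k_r` for `1 ≤ r ≤ total + 1`, with `k_1 = a_{+0}` and `k_{total + 1} = c_{N0}`
(never used for other `r`). -/
noncomputable def k (r : ℕ) : PathAlg X K :=
  if r = 1 then arr K .ap0
  else if r = X.total + 1 then arr K .cN0
  else if h : r ∈ Finset.Icc 2 X.total then arr K (.k ⟨r, h⟩) else 0

/-- The path `C_{0t} = c_{0+} c_{+1} c_{12} ⋯ c_{t-1,t}`, for `1 ≤ t ≤ N`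
(never used for `t = 0`). -/
noncomputable def C : ℕ → PathAlg X K
  | 0 => 0
  | 1 => arr K .c0p * arr K .cp1
  | t + 2 => C (t + 1) * c X K (t + 1)

/-- `C_{0B}` with `B` the tail of `k_r`: this tail is `+` for `r = 1`, where
`C_{0+} = c_{0+}`, and the vertex `b r` for `r ≥ 2`. -/
noncomputable def CButt (r : ℕ) : PathAlg X K :=
  if r = 1 then arr K .c0p else C X K (X.b r)

/-- The path `a_{0N} a_{N,N-1} ⋯ a_{N-s+1,N-s}`. -/
noncomputable def AAux : ℕ → PathAlg X K
  | 0 => arr K .a0N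
  | s + 1 => AAux s * a X K (X.N - (s + 1))

/-- The path `A_{0t} = a_{0N} a_{N,N-1} ⋯ a_{t+1,t}`, for `1 ≤ t ≤ N`. -/
noncomputable def A (t : ℕ) : PathAlg X K := AAux X K (X.N - t)

end PathAlg

open PathAlg in
/-- The defining relations of the reconstruction algebra of type `D`, in the moduli
presentation. -/
inductive ReconRel : PathAlg X K → PathAlg X K → Prop
  | rel1 : ReconRel (arr K .c0p * arr K .cp1 - arr K .c0m * arr K .cm1) (4 * A X K 1)
  | rel2 : ReconRel (arr K .c0p * arr K .ap0) (arr K .c0m * arr K .am0)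
  | rel3 : ReconRel (arr K .am0 * arr K .c0m) (arr K .cm1 * arr K .a1m)
  | rel4 : ReconRel (arr K .a1p * arr K .cp1) (arr K .a1m * arr K .cm1)
  | step0 : ReconRel (arr K .ap0 * arr K .c0p) (arr K .cp1 * arr K .a1p)
  -- Step 1
  | step1_eq : X.α 1 = 3 → ReconRel (c X K 1 * a X K 1) (arr K .a1p * arr K .cp1)
  | step1_kA : 3 < X.α 1 → ReconRel (k X K 2 * A X K 1) (arr K .a1p * arr K .cp1)
  | step1_Ak : 3 < X.α 1 → ReconRel (A X K 1 * k X K 2) (arr K .c0p * arr K .ap0)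
  | step1_kC (t : ℕ) : 3 < X.α 1 → 2 ≤ t → t < X.u 1 →
      ReconRel (k X K t * C X K 1) (k X K (t + 1) * A X K 1)
  | step1_Ck (t : ℕ) : 3 < X.α 1 → 2 ≤ t → t < X.u 1 →
      ReconRel (C X K 1 * k X K t) (A X K 1 * k X K (t + 1))
  | step1_last : 3 < X.α 1 → ReconRel (k X K (X.u 1) * C X K 1) (c X K 1 * a X K 1)
  -- Step i, for 2 ≤ i < N
  | step_eq (i : ℕ) : 2 ≤ i → i < X.N → X.α i = 2 →
      ReconRel (c X K i * a X K i) (a X K (i - 1) * c X K (i - 1))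
  | step_kA (i : ℕ) : 2 ≤ i → i < X.N → 2 < X.α i →
      ReconRel (k X K (X.v i) * A X K i) (a X K (i - 1) * c X K (i - 1))
  | step_Ak (i : ℕ) : 2 ≤ i → i < X.N → 2 < X.α i →
      ReconRel (A X K i * k X K (X.v i)) (CButt X K (X.V i) * k X K (X.V i))
  | step_kC (i t : ℕ) : 2 ≤ i → i < X.N → 2 < X.α i → X.v i ≤ t → t < X.u i →
      ReconRel (k X K t * C X K i) (k X K (t + 1) * A X K i)
  | step_Ck (i t : ℕ) : 2 ≤ i → i < X.N → 2 < X.α i → X.v i ≤ t → t < X.u i →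
      ReconRel (C X K i * k X K t) (A X K i * k X K (t + 1))
  | step_last (i : ℕ) : 2 ≤ i → i < X.N → 2 < X.α i →
      ReconRel (k X K (X.u i) * C X K i) (c X K i * a X K i)
  -- Step N
  | stepN_eq_ca : X.α X.N = 2 →
      ReconRel (arr K .cN0 * arr K .a0N) (a X K (X.N - 1) * c X K (X.N - 1))
  | stepN_eq_Ck : X.α X.N = 2 →
      ReconRel (CButt X K (X.V X.N) * k X K (X.V X.N)) (arr K .a0N * arr K .cN0)
  | stepN_kA : 2 < X.α X.N →
      ReconRel (k X K (X.v X.N) * arr K .a0N) (a X K (X.N - 1) * c X K (X.N - 1))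
  | stepN_Ak : 2 < X.α X.N →
      ReconRel (arr K .a0N * k X K (X.v X.N)) (CButt X K (X.V X.N) * k X K (X.V X.N))
  | stepN_kC (t : ℕ) : 2 < X.α X.N → X.v X.N ≤ t → t < X.u X.N →
      ReconRel (k X K t * C X K X.N) (k X K (t + 1) * arr K .a0N)
  | stepN_Ck (t : ℕ) : 2 < X.α X.N → X.v X.N ≤ t → t < X.u X.N →
      ReconRel (C X K X.N * k X K t) (arr K .a0N * k X K (t + 1))

/-- The reconstruction algebra `D_{n,q}` of type `D` (moduli presentation). -/
abbrev ReconAlg := RingQuot (ReconRel X K)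

/-- The quotient map from the path algebra onto the reconstruction algebra. -/
noncomputable abbrev proj : PathAlg X K →ₐ[K] ReconAlg X K := RingQuot.mkAlgHom K (ReconRel X K)

/-! ## Representations of dimension vector `(1, …, 1)` and stability -/

/-- A representation of `D_{n,q}` of dimension vector `(1, …, 1)`, with one basis vector chosen
at each vertex: the space `⨁_v K` of row vectors, on which the algebra acts on the right through
matrices, the trivial path at `v` acting as the projection to the `v`-th summand. So an arrow
`x` from `i` to `j` acts through the single entry `(i, j)`, which is the value of the
representation at `x`. -/
@[ext]
structure Rep where
  toHom : ReconAlg X K →ₐ[K] Matrix (Vertex X) (Vertex X) K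
  map_e : ∀ v : Vertex X, toHom (proj X K (PathAlg.e K v)) = Matrix.single v v 1

variable {X K}

/-- The value (a scalar) of a representation at an arrow. -/
noncomputable def Rep.val (M : Rep X K) (x : Arrow X) : K :=
  M.toHom (proj X K (PathAlg.arr K x)) x.tail x.head

/-- `θ`-stability: every subrepresentation `W` other than `0` and the whole representation
satisfies `∑_v θ_v dim W_v > 0`. Here `W_v`, the space of `W` at `v`, is the image of `W` under
the projection to the coordinate `v`. -/
def Rep.IsStable (θ : Vertex X → ℤ) (M : Rep X K) : Prop :=
  ∀ W : Submodule K (Vertex X → K),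
    (∀ (d : ReconAlg X K), ∀ w ∈ W, w ᵥ* M.toHom d ∈ W) → W ≠ ⊥ → W ≠ ⊤ →
      0 < ∑ v, θ v * (Module.finrank K
        (W.map (LinearMap.proj v : (Vertex X → K) →ₗ[K] K)) : ℤ)

variable (X) in
/-- The stability condition `θ = (-(N + 2), 1, …, 1)`, with `-(N + 2)` at `⋆`. -/
def theta : Vertex X → ℤ
  | .star => -((X.N : ℤ) + 2)
  | _ => 1

/-! ## The moduli space -/

/-- The Zariski topology on the affine space `K ^ ι`. -/
abbrev zariski (ι K : Type*) [Field K] : TopologicalSpace (ι → K) :=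
  TopologicalSpace.generateFrom
    {s | ∃ p : MvPolynomial ι K, s = {x | MvPolynomial.eval x p ≠ 0}}

/-- The Zariski topology on the space of representations, as a subspace of the affine space of
all values at the arrows. -/
noncomputable instance : TopologicalSpace (Rep X K) :=
  TopologicalSpace.induced Rep.val (zariski (Arrow X) K)

variable (X K) in
/-- The `θ`-stable representations. -/
abbrev StableRep := {M : Rep X K // M.IsStable (theta X)}

/-- Two stable representations are isomorphic if they lie in one orbit under change of basis,
that is under the group `∏_v GL₁(K)`. -/
instance stableSetoid : Setoid (StableRep X K) where
  r M M' := ∃ g : Vertex X → Kˣ, ∀ (d : ReconAlg X K) (i j : Vertex X),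
    M'.1.toHom d i j = (g i : K) * M.1.toHom d i j * ((g j)⁻¹ : Kˣ)
  iseqv :=
    { refl := fun M => ⟨1, fun d i j => by simp⟩
      symm := by
        rintro M M' ⟨g, h⟩
        refine ⟨g⁻¹, fun d i j => ?_⟩
        rw [h d i j]
        simp [mul_assoc]
      trans := by
        rintro M M' M'' ⟨g, h⟩ ⟨g', h'⟩
        refine ⟨g' * g, fun d i j => ?_⟩
        rw [h' d i j, h d i j]
        simp [mul_assoc, mul_comm, mul_left_comm] }

variable (X K) in
/-- The moduli space of `θ`-stable representations of `D_{n,q}` of dimension vector `(1, …, 1)`: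
the orbit space of the stable locus, with the quotient of the Zariski topology. -/
def Moduli := Quotient (stableSetoid (X := X) (K := K))

noncomputable instance : TopologicalSpace (Moduli X K) :=
  inferInstanceAs (TopologicalSpace (Quotient (stableSetoid (X := X) (K := K))))

/-- The path (or element of the path algebra) `p` is non-zero in the representation `m`; this
does not depend on the choice of the representative of the isomorphism class. -/
def Moduli.NonZero (m : Moduli X K) (p : PathAlg X K) : Prop :=
  Quotient.lift (fun M : StableRep X K => M.1.toHom (proj X K p) ≠ 0) (by
    rintro M M' ⟨g, h⟩
    simp only [ne_eq, eq_iff_iff, not_iff_not, ← Matrix.ext_iff, Matrix.zero_apply, h]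
    simp) m

open PathAlg

variable (X K)

/-- The sets `U_0, …, U_N`: for `t = 0` given by `C_{0N} ≠ 0`, `c_{0-} ≠ 0`; for
`1 ≤ t ≤ N - 1` by `C_{0,N-t} ≠ 0`, `c_{0-} ≠ 0`, `A_{0,N-t+1} ≠ 0`; for `t = N` by
`c_{0+} ≠ 0`, `c_{0-} ≠ 0`, `A_{01} ≠ 0`. -/
def U (t : ℕ) : Set (Moduli X K) :=
  if t = 0 then {m | m.NonZero (C X K X.N) ∧ m.NonZero (arr K .c0m)}
  else if t = X.N then
    {m | m.NonZero (arr K .c0p) ∧ m.NonZero (arr K .c0m) ∧ m.NonZero (A X K 1)}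
  else
    {m | m.NonZero (C X K (X.N - t)) ∧ m.NonZero (arr K .c0m) ∧
      m.NonZero (A X K (X.N - t + 1))}

/-- `U_+`: `c_{0+} ≠ 0`, `A_{01} ≠ 0`, `a_{1-} ≠ 0`. -/
def UPlus : Set (Moduli X K) :=
  {m | m.NonZero (arr K .c0p) ∧ m.NonZero (A X K 1) ∧ m.NonZero (arr K .a1m)}

/-- `U_-`: `c_{0-} ≠ 0`, `A_{01} ≠ 0`, `a_{1+} ≠ 0`. -/
def UMinus : Set (Moduli X K) :=
  {m | m.NonZero (arr K .c0m) ∧ m.NonZero (A X K 1) ∧ m.NonZero (arr K .a1p)}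

end ReconD

namespace ReconD

open PathAlg

/-! ### Arrows as matrix units; generators of the algebra -/

section Generators

variable {X : Datum} {K : Type*} [Field K]

/-! Openness: each of the sets is cut out by non-vanishing of finitely many paths, and a path acts
through a single matrix entry, a monomial in the arrow values (`IsMonomial`). Its non-vanishing
locus is therefore a basic Zariski open set, saturated for the group action.

Covering: beyond stability, only the relation C_{01} - c_{0-}c_{-1} = 4A_{01} is needed. By
`Rep.IsStable.mem_of_closed`, a set of vertices that contains ⋆ and is closed under non-zero arrows
is everything; applied to well-chosen sets, this forces particular paths to be non-zero. If C_{01} =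
0, then A_{01} ≠ 0, since otherwise all ways to reach the vertex 1 vanish; hence c_{0-} ≠ 0, and the
point lies in U_N or U_- according to whether c_{0+} ≠ 0. If C_{01} ≠ 0 and c_{0-} = 0, then A_{01}
≠ 0 by the relation and a_{1-} ≠ 0 because - must be reached: this is U_+. If both are non-zero,
follow the paths C_{0t}: either C_{0N} ≠ 0 (U_0), or they first vanish after some t, and then t + 1
must be reached from the other side, along A_{0,t+1} (U_{N-t}). -/

theorem PathAlg.e_tail_mul_arr_mul_e_head (x : Arrow X) :
    e K x.tail * arr K x * e K x.head = arr K x := by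
  have h1 : e K x.tail * arr K x = arr K x := by
    rw [e, arr, ← map_mul]
    exact RingQuot.mkAlgHom_rel K (PathRel.tail_mul x)
  have h2 : arr K x * e K x.head = arr K x := by
    rw [e, arr, ← map_mul]
    exact RingQuot.mkAlgHom_rel K (PathRel.mul_head x)
  rw [h1, h2]

/-- The matrix through which an element of the path algebra acts on a representation. -/
noncomputable def Rep.mat (M : Rep X K) : PathAlg X K →ₐ[K] Matrix (Vertex X) (Vertex X) K :=
  M.toHom.comp (proj X K)

theorem Rep.mat_arr (M : Rep X K) (x : Arrow X) :
    M.mat (arr K x) = Matrix.single x.tail x.head (M.val x) := by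
  have h : ∀ v, M.mat (e K v) = Matrix.single v v 1 := M.map_e
  rw [← PathAlg.e_tail_mul_arr_mul_e_head, map_mul, map_mul, h, h,
    Matrix.single_mul_mul_single]
  simp [Rep.mat, Rep.val]

/-- Induction principle: a property of elements of the reconstruction algebra that holds for
scalars, trivial paths and arrows, and is closed under sums and products, holds everywhere. -/
theorem ReconAlg.induction {P : ReconAlg X K → Prop}
    (scalar : ∀ r : K, P (algebraMap K _ r)) (vertex : ∀ v, P (proj X K (e K v)))
    (arrow : ∀ x, P (proj X K (arr K x))) (add : ∀ x y, P x → P y → P (x + y))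
    (mul : ∀ x y, P x → P y → P (x * y)) (d : ReconAlg X K) : P d := by
  obtain ⟨p, rfl⟩ := RingQuot.mkAlgHom_surjective K (ReconRel X K) d
  obtain ⟨f, rfl⟩ := RingQuot.mkAlgHom_surjective K _ p
  induction f using FreeAlgebra.induction with
  | grade0 r => simpa only [AlgHom.commutes] using scalar r
  | grade1 x => exact x.casesOn vertex arrow
  | mul f g hf hg => simpa only [map_mul] using mul _ _ hf hg
  | add f g hf hg => simpa only [map_add] using add _ _ hf hg

end Generators

/-! ### Stability as reachability from ⋆ -/

section Stability

variable {X : Datum} {K : Type*} [Field K]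

/-- The vertices, as a disjoint union of three points and the interval `1, …, N`. -/
def Vertex.equivSum (X : Datum) :
    Vertex X ≃ Unit ⊕ Unit ⊕ Unit ⊕ (Finset.Icc 1 X.N) where
  toFun
    | .star => .inl ()
    | .plus => .inr (.inl ())
    | .minus => .inr (.inr (.inl ()))
    | .node i => .inr (.inr (.inr i))
  invFun
    | .inl _ => .star
    | .inr (.inl _) => .plus
    | .inr (.inr (.inl _)) => .minus
    | .inr (.inr (.inr i)) => .node i
  left_inv v := by cases v <;> rfl
  right_inv v := by rcases v with _ | _ | _ | _ <;> rfl

theorem sum_theta (X : Datum) : ∑ v, theta X v = 0 := by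
  rw [← (Vertex.equivSum X).symm.sum_comp]
  simp [Fintype.sum_sum_type, Vertex.equivSum, theta]
  ring

/-- The vectors supported on a set of vertices. -/
def supportedOn (K : Type*) [Field K] (S : Set (Vertex X)) : Submodule K (Vertex X → K) where
  carrier := {w | ∀ v ∉ S, w v = 0}
  add_mem' ha hb v hv := by simp [ha v hv, hb v hv]
  zero_mem' v _ := rfl
  smul_mem' r w hw v hv := by simp [hw v hv]

theorem single_mem_supportedOn {S : Set (Vertex X)} {v : Vertex X} (hv : v ∈ S) :
    Pi.single v (1 : K) ∈ supportedOn K S := fun w hw =>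
  Pi.single_eq_of_ne (by rintro rfl; exact hw hv) _

/-- Invariance passes to sums and products, so it is enough to test trivial paths and arrows, and a
non-zero arrow only moves its tail coordinate to its head. -/
theorem Rep.supportedOn_invariant (M : Rep X K) {S : Set (Vertex X)}
    (hS : ∀ x : Arrow X, x.tail ∈ S → M.mat (arr K x) ≠ 0 → x.head ∈ S)
    (d : ReconAlg X K) : ∀ w ∈ supportedOn K S, w ᵥ* M.toHom d ∈ supportedOn K S := by
  induction d using ReconAlg.induction with
  | scalar r =>
    intro w hw
    rw [AlgHom.commutes, Algebra.algebraMap_eq_smul_one, Matrix.vecMul_smul, Matrix.vecMul_one]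
    exact Submodule.smul_mem _ _ hw
  | vertex v =>
    intro w hw u hu
    have : v = u → w v = 0 := fun h => h ▸ hw u hu
    rw [M.map_e]
    simpa [Matrix.vecMul, dotProduct, Matrix.single_apply, ite_and]
  | arrow x =>
    intro w hw u hu
    change (w ᵥ* M.mat (arr K x)) u = 0
    by_cases h0 : M.mat (arr K x) = 0
    · simp [h0]
    by_cases ht : x.tail ∈ S
    · have hne : x.head ≠ u := fun h => hu (h ▸ hS x ht h0)
      simp [M.mat_arr, Matrix.vecMul, dotProduct, hne]
    · simp [M.mat_arr, Matrix.vecMul, dotProduct, Matrix.single_apply, ite_and, hw _ ht]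
  | add x y hx hy =>
    intro w hw
    rw [map_add, Matrix.vecMul_add]
    exact Submodule.add_mem _ (hx w hw) (hy w hw)
  | mul x y hx hy =>
    intro w hw
    rw [map_mul, ← Matrix.vecMul_vecMul]
    exact hy _ (hx w hw)

/-- In a `θ`-stable representation every vertex can be reached from `⋆` along non-zero arrows. -/
theorem Rep.IsStable.mem_of_closed {M : Rep X K} (hM : M.IsStable (theta X))
    {S : Set (Vertex X)} (h0 : .star ∈ S)
    (hS : ∀ x : Arrow X, x.tail ∈ S → M.mat (arr K x) ≠ 0 → x.head ∈ S) (v : Vertex X) :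
    v ∈ S := by
  by_contra hv
  have hpos := hM (supportedOn K S) (M.supportedOn_invariant hS)
    (fun h => by
      have := single_mem_supportedOn (K := K) h0
      rw [h, Submodule.mem_bot] at this
      simpa using congrFun this .star)
    (fun h => by
      have : Pi.single v (1 : K) ∈ supportedOn K S := h ▸ Submodule.mem_top
      simpa using this v hv)
  -- The only negative weight, at ⋆, is counted in full, and the positive ones at most once each, so
  -- the weighted sum is at most the total weight 0.
  refine absurd hpos (not_lt.2 ?_)
  rw [← sum_theta X]
  refine Finset.sum_le_sum fun u _ => ?_
  set F := (supportedOn K S).map (LinearMap.proj u : (Vertex X → K) →ₗ[K] K) with hF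
  have hle : Module.finrank K F ≤ 1 := by
    simpa using Submodule.finrank_le F
  by_cases hu : u = .star
  · subst hu
    have hone : (1 : K) ∈ F := ⟨Pi.single .star 1, single_mem_supportedOn h0, by simp⟩
    have : F = ⊤ := (Submodule.eq_top_iff').2 fun r => by
      simpa using F.smul_mem r hone
    rw [this, finrank_top, Module.finrank_self, Nat.cast_one, mul_one]
  · have : theta X u = 1 := by cases u <;> first | rfl | exact absurd rfl hu
    rw [this, one_mul]
    exact_mod_cast hle

end Stability

/-! ### Paths act as monomials in the arrow values -/

section Paths

variable {X : Datum} {K : Type*} [Field K]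

/-- `p` acts on every representation through its `(i, j)` entry, which is a monomial in the
values at the arrows. -/
def IsMonomial (p : PathAlg X K) (i j : Vertex X) : Prop :=
  ∃ l : List (Arrow X), ∀ M : Rep X K, M.mat p = Matrix.single i j (l.map M.val).prod

theorem isMonomial_arr (x : Arrow X) : IsMonomial (arr K x) x.tail x.head :=
  ⟨[x], fun M => by simp [M.mat_arr]⟩

theorem IsMonomial.mul {p q : PathAlg X K} {i j l : Vertex X} (hp : IsMonomial p i j)
    (hq : IsMonomial q j l) : IsMonomial (p * q) i l := by
  obtain ⟨s, hs⟩ := hp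
  obtain ⟨t, ht⟩ := hq
  exact ⟨s ++ t, fun M => by simp [hs, ht]⟩

theorem single_ne_zero_iff {i j : Vertex X} {r : K} : Matrix.single i j r ≠ 0 ↔ r ≠ 0 := by
  refine not_congr ⟨fun h => ?_, fun h => by rw [h, Matrix.single_zero]⟩
  simpa using congrFun (congrFun h i) j

/-- The two entries are scalars in a field, so composable paths multiply without cancellation; every
prefix of a non-zero path is non-zero. -/
theorem IsMonomial.mat_mul_ne_zero {p q : PathAlg X K} {i j l : Vertex X}
    (hp : IsMonomial p i j) (hq : IsMonomial q j l) (M : Rep X K) :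
    M.mat (p * q) ≠ 0 ↔ M.mat p ≠ 0 ∧ M.mat q ≠ 0 := by
  obtain ⟨s, hs⟩ := hp
  obtain ⟨t, ht⟩ := hq
  rw [map_mul, hs, ht, Matrix.single_mul_single_same]
  simp only [single_ne_zero_iff, mul_ne_zero_iff]

theorem PathAlg.c_eq {t : ℕ} (h1 : 1 ≤ t) (h2 : t < X.N) :
    c X K t = arr K (.c ⟨t, Finset.mem_Ico.2 ⟨h1, h2⟩⟩) := dif_pos _

theorem PathAlg.a_eq {t : ℕ} (h1 : 1 ≤ t) (h2 : t < X.N) :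
    a X K t = arr K (.a ⟨t, Finset.mem_Ico.2 ⟨h1, h2⟩⟩) := dif_pos _

theorem isMonomial_c {t : ℕ} (h1 : 1 ≤ t) (h2 : t < X.N) :
    IsMonomial (c X K t) (.mk t h1 h2.le) (.mk (t + 1) (Nat.le_add_left _ _) h2) := by
  rw [PathAlg.c_eq h1 h2]
  exact isMonomial_arr _

theorem isMonomial_a {t : ℕ} (h1 : 1 ≤ t) (h2 : t < X.N) :
    IsMonomial (a X K t) (.mk (t + 1) (Nat.le_add_left _ _) h2) (.mk t h1 h2.le) := by
  rw [PathAlg.a_eq h1 h2]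
  exact isMonomial_arr _

theorem PathAlg.C_succ {t : ℕ} (h1 : 1 ≤ t) : C X K (t + 1) = C X K t * c X K t := by
  obtain ⟨t, rfl⟩ := Nat.exists_eq_add_of_le' h1
  rfl

theorem PathAlg.A_last : A X K X.N = arr K .a0N := by simp [A, AAux]

theorem PathAlg.A_eq_mul {t : ℕ} (h2 : t < X.N) : A X K t = A X K (t + 1) * a X K t := by
  rw [A, A, show X.N - t = X.N - (t + 1) + 1 by omega, AAux,
    show X.N - (X.N - (t + 1) + 1) = t by omega]

theorem isMonomial_C {t : ℕ} (h1 : 1 ≤ t) (h2 : t ≤ X.N) :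
    IsMonomial (C X K t) .star (.mk t h1 h2) := by
  induction t, h1 using Nat.le_induction with
  | base => exact (isMonomial_arr .c0p).mul (isMonomial_arr .cp1)
  | succ t h1 ih =>
    rw [PathAlg.C_succ h1]
    exact (ih (by omega)).mul (isMonomial_c h1 (by omega))

theorem isMonomial_A {t : ℕ} (h1 : 1 ≤ t) (h2 : t ≤ X.N) :
    IsMonomial (A X K t) .star (.mk t h1 h2) := by
  induction h2 using Nat.decreasingInduction with
  | self =>
    rw [PathAlg.A_last]
    exact isMonomial_arr .a0N
  | of_succ t h2 ih =>
    rw [PathAlg.A_eq_mul h2]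
    exact (ih (by omega)).mul (isMonomial_a h1 h2)

end Paths

/-! ### Openness of the sets -/

section Open

variable {X : Datum} {K : Type*} [Field K]

theorem IsMonomial.isOpen_nonZero {p : PathAlg X K} {i j : Vertex X} (hp : IsMonomial p i j) :
    IsOpen {m : Moduli X K | m.NonZero p} := by
  obtain ⟨l, hl⟩ := hp
  refine isOpen_coinduced.2 (isOpen_induced_iff.2
    ⟨{M : Rep X K | M.mat p ≠ 0}, isOpen_induced_iff (t := zariski (Arrow X) K) |>.2
      ⟨_, TopologicalSpace.isOpen_generateFrom_of_mem
        -- The polynomial is the product of the variables along the path.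
        ⟨(l.map MvPolynomial.X).prod, rfl⟩, ?_⟩, rfl⟩)
  ext M
  simp [hl, single_ne_zero_iff, map_list_prod, Function.comp_def]

theorem isOpen_U {t : ℕ} (ht : t ≤ X.N) : IsOpen (U X K t) := by
  have := X.one_le_N
  unfold U
  split_ifs with h0 hN
  · exact (isMonomial_C X.one_le_N le_rfl).isOpen_nonZero.inter
      (isMonomial_arr .c0m).isOpen_nonZero
  · exact (isMonomial_arr .c0p).isOpen_nonZero.inter
      ((isMonomial_arr .c0m).isOpen_nonZero.inter
        (isMonomial_A le_rfl X.one_le_N).isOpen_nonZero)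
  · exact (isMonomial_C (by omega) (by omega)).isOpen_nonZero.inter
      ((isMonomial_arr .c0m).isOpen_nonZero.inter
        (isMonomial_A (by omega) (by omega)).isOpen_nonZero)

theorem isOpen_UPlus : IsOpen (UPlus X K) :=
  (isMonomial_arr .c0p).isOpen_nonZero.inter
    ((isMonomial_A le_rfl X.one_le_N).isOpen_nonZero.inter
      (isMonomial_arr .a1m).isOpen_nonZero)

theorem isOpen_UMinus : IsOpen (UMinus X K) :=
  (isMonomial_arr .c0m).isOpen_nonZero.inter
    ((isMonomial_A le_rfl X.one_le_N).isOpen_nonZero.inter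
      (isMonomial_arr .a1p).isOpen_nonZero)

end Open

/-! ### The sets cover the moduli space -/

section Cover

variable {X : Datum} {K : Type*} [Field K]

theorem Rep.mat_rel1 (M : Rep X K) :
    M.mat (C X K 1) - M.mat (arr K .c0m * arr K .cm1) = (4 : K) • M.mat (A X K 1) := by
  have h := congrArg M.toHom (RingQuot.mkAlgHom_rel K (ReconRel.rel1 (X := X) (K := K)))
  rw [← map_sub, ← map_smul, ofNat_smul_eq_nsmul, nsmul_eq_mul, Nat.cast_ofNat]
  exact h

/-- These are the only two arrows into -; if both vanished, the complement of - would be closed. -/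
theorem Rep.IsStable.c0m_or_a1m {M : Rep X K} (hM : M.IsStable (theta X)) :
    M.mat (arr K .c0m) ≠ 0 ∨ M.mat (arr K .a1m) ≠ 0 := by
  by_contra! h
  refine hM.mem_of_closed (S := {.minus}ᶜ) (by simp) (fun x _ hx => ?_) .minus rfl
  cases x <;> simp_all [Arrow.head, Vertex.mk]

theorem Rep.IsStable.c0p_or_a1p {M : Rep X K} (hM : M.IsStable (theta X)) :
    M.mat (arr K .c0p) ≠ 0 ∨ M.mat (arr K .a1p) ≠ 0 := by
  by_contra! h
  refine hM.mem_of_closed (S := {.plus}ᶜ) (by simp) (fun x _ hx => ?_) .plus rfl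
  cases x <;> simp_all [Arrow.head, Vertex.mk]

theorem Rep.mat_A_of_succ {M : Rep X K} {t : ℕ} (h1 : 1 ≤ t) (h2 : t < X.N)
    (hA : M.mat (A X K (t + 1)) ≠ 0) (ha : M.mat (a X K t) ≠ 0) : M.mat (A X K t) ≠ 0 := by
  rw [PathAlg.A_eq_mul h2]
  exact ((isMonomial_A (Nat.le_add_left _ _) h2).mat_mul_ne_zero (isMonomial_a h1 h2) M).2
    ⟨hA, ha⟩

/-- A set of vertices that contains `⋆`, described by conditions at `+`, at `-` and at `i`. -/
def vertexSet (p m : Prop) (P : ℕ → Prop) : Set (Vertex X)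
  | .star => True
  | .plus => p
  | .minus => m
  | .node i => P i

/-- If `c_{t,t+1}` vanishes, then the vertex `t + 1` is reached along `A_{0,t+1}`. -/
theorem Rep.IsStable.A_succ_ne_zero {M : Rep X K} (hM : M.IsStable (theta X)) {t : ℕ}
    (h1 : 1 ≤ t) (h2 : t < X.N) (hc : M.mat (c X K t) = 0) : M.mat (A X K (t + 1)) ≠ 0 := by
  -- Vertices up to t are admitted freely: the only arrow from them into the part beyond t is
  -- c_{t,t+1}, which is zero.
  refine hM.mem_of_closed (S := vertexSet True True fun i => t < i → M.mat (A X K i) ≠ 0)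
    trivial (fun x hx h => ?_) (.mk (t + 1) (Nat.le_add_left _ _) h2) (Nat.lt_succ_self t)
  cases x with
  | c s =>
    obtain ⟨s, hs⟩ := s
    obtain ⟨hs1, hs2⟩ := Finset.mem_Ico.1 hs
    rw [← PathAlg.c_eq hs1 hs2] at h
    intro (hts : t < s + 1)
    have hne : t ≠ s := by rintro rfl; exact h hc
    have hA : M.mat (A X K s) ≠ 0 := hx (show t < s by omega)
    -- Moving right from s to s + 1 stays in the set because A_{0,s+1} is a prefix of A_{0s}.
    rw [PathAlg.A_eq_mul hs2, (isMonomial_A (Nat.le_add_left _ _) hs2).mat_mul_ne_zero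
      (isMonomial_a hs1 hs2)] at hA
    exact hA.1
  | a s =>
    obtain ⟨s, hs⟩ := s
    obtain ⟨hs1, hs2⟩ := Finset.mem_Ico.1 hs
    rw [← PathAlg.a_eq hs1 hs2] at h
    exact fun (hts : t < s) => mat_A_of_succ hs1 hs2 (hx (show t < s + 1 by omega)) h
  | a0N => exact fun _ => by rwa [PathAlg.A_last]
  | cp1 => exact fun (h' : t < 1) => by omega
  | cm1 => exact fun (h' : t < 1) => by omega
  | _ => trivial

/-- The vertex `1` is reached from `⋆` along one of `C_{01}`, `c_{0-} c_{-1}` and `A_{01}`. -/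
theorem Rep.IsStable.node_one_reached {M : Rep X K} (hM : M.IsStable (theta X))
    (hC : M.mat (C X K 1) = 0) (hm : M.mat (arr K .c0m * arr K .cm1) = 0) :
    M.mat (A X K 1) ≠ 0 := by
  by_contra hA
  -- This set omits the vertex 1, so a_{1+} and a_{1-} impose no condition, and the hypotheses block
  -- entry into 1 from + and -.
  refine hM.mem_of_closed (S := vertexSet (M.mat (arr K .c0p) ≠ 0) (M.mat (arr K .c0m) ≠ 0)
    fun i => M.mat (A X K i) ≠ 0) trivial (fun x hx h => ?_) (.mk 1 le_rfl X.one_le_N) hA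
  cases x with
  | c s =>
    obtain ⟨s, hs⟩ := s
    obtain ⟨hs1, hs2⟩ := Finset.mem_Ico.1 hs
    replace hx : M.mat (A X K s) ≠ 0 := hx
    rw [PathAlg.A_eq_mul hs2, (isMonomial_A (Nat.le_add_left _ _) hs2).mat_mul_ne_zero
      (isMonomial_a hs1 hs2)] at hx
    exact hx.1
  | a s =>
    obtain ⟨s, hs⟩ := s
    obtain ⟨hs1, hs2⟩ := Finset.mem_Ico.1 hs
    rw [← PathAlg.a_eq hs1 hs2] at h
    exact mat_A_of_succ hs1 hs2 hx h
  | a0N =>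
    change M.mat (A X K X.N) ≠ 0
    rwa [PathAlg.A_last]
  | cp1 =>
    exact absurd hC (((isMonomial_arr .c0p).mat_mul_ne_zero (isMonomial_arr .cp1) M).2 ⟨hx, h⟩)
  | cm1 =>
    exact absurd hm (((isMonomial_arr .c0m).mat_mul_ne_zero (isMonomial_arr .cm1) M).2 ⟨hx, h⟩)
  | a1p => exact absurd hA hx
  | a1m => exact absurd hA hx
  | c0p => exact h
  | c0m => exact h
  | _ => trivial

theorem Moduli.mem_cover [CharZero K] (m : Moduli X K) :
    (∃ t ≤ X.N, m ∈ U X K t) ∨ m ∈ UPlus X K ∨ m ∈ UMinus X K := by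
  obtain ⟨⟨M, hM⟩, rfl⟩ := Quotient.exists_rep m
  have hN := X.two_le_N
  have hrel := M.mat_rel1
  have hCm := (isMonomial_arr .c0p).mat_mul_ne_zero (isMonomial_arr .cp1) M
  have hMm := (isMonomial_arr .c0m).mat_mul_ne_zero (isMonomial_arr .cm1) M
  by_cases hC1 : M.mat (C X K 1) = 0
  · have hA : M.mat (A X K 1) ≠ 0 := by
      intro hA
      refine hM.node_one_reached hC1 ?_ hA
      simpa [hC1, hA] using hrel
    -- The relation reads -c_{0-}c_{-1} = 4A_{01}, and 4 is invertible in characteristic zero.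
    have hm : M.mat (arr K .c0m) ≠ 0 := by
      refine (hMm.1 fun h => hA ?_).1
      simpa [hC1, h] using hrel.symm
    by_cases hp : M.mat (arr K .c0p) = 0
    · exact .inr (.inr ⟨hm, hA, hM.c0p_or_a1p.resolve_left (not_not.2 hp)⟩)
    · refine .inl ⟨X.N, le_rfl, ?_⟩
      rw [U, if_neg (by omega), if_pos rfl]
      exact ⟨hp, hm, hA⟩
  by_cases hm : M.mat (arr K .c0m) = 0
  · refine .inr (.inl ⟨(hCm.1 hC1).1, fun hA => hC1 ?_, hM.c0m_or_a1m.resolve_left (not_not.2 hm)⟩)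
    replace hA : M.mat (A X K 1) = 0 := hA
    simpa [hm, hA] using hrel
  by_cases hCN : M.mat (C X K X.N) = 0
  -- A place where the path breaks: C_{01} ≠ 0 and C_{0N} = 0, so the vanishing starts at some step
  -- t → t + 1, and there c_{t,t+1} = 0.
  · obtain ⟨t, h1, h2, hCt, hCt'⟩ : ∃ t, 1 ≤ t ∧ t < X.N ∧ M.mat (C X K t) ≠ 0 ∧
        M.mat (C X K (t + 1)) = 0 := by
      by_contra! h
      refine Nat.le_induction (P := fun t _ => t ≤ X.N → M.mat (C X K t) ≠ 0) (fun _ => hC1)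
        (fun t h1 ih h2 => h t h1 h2 (ih (by omega))) X.N X.one_le_N le_rfl hCN
    have hc : M.mat (c X K t) = 0 := by
      by_contra hc
      rw [PathAlg.C_succ h1] at hCt'
      exact ((isMonomial_C h1 h2.le).mat_mul_ne_zero (isMonomial_c h1 h2) M).2 ⟨hCt, hc⟩ hCt'
    refine .inl ⟨X.N - t, by omega, ?_⟩
    rw [U, if_neg (by omega), if_neg (by omega), Nat.sub_sub_self h2.le]
    exact ⟨hCt, hm, hM.A_succ_ne_zero h1 h2 hc⟩
  · refine .inl ⟨0, Nat.zero_le _, ?_⟩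
    rw [U, if_pos rfl]
    exact ⟨hCN, hm⟩

end Cover

end ReconD

theorem mainTheorem9 (K : Type*) [Field K] [IsAlgClosed K] [CharZero K] (X : ReconD.Datum) :
    (∀ t ≤ X.N, IsOpen (ReconD.U X K t)) ∧
    IsOpen (ReconD.UPlus X K) ∧
    IsOpen (ReconD.UMinus X K) ∧
    (⋃ t ∈ Finset.range (X.N + 1), ReconD.U X K t) ∪ ReconD.UPlus X K ∪ ReconD.UMinus X K =
      (Set.univ : Set (ReconD.Moduli X K)) := by
  refine ⟨fun t ht => ReconD.isOpen_U ht, ReconD.isOpen_UPlus, ReconD.isOpen_UMinus,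
    Set.eq_univ_of_forall fun m => ?_⟩
  rcases m.mem_cover with ⟨t, ht, h⟩ | h | h
  · exact .inl (.inl (Set.mem_biUnion (by simpa [Nat.lt_succ_iff] using ht) h))
  · exact .inl (.inr h)
  · exact .inr h
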